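/- Let $X$ be a finite-dimensional real inner product space with induced norm $\|\cdot\|$, and let $B:X\rightrightarrows X$ be a maximal monotone operator with $B^{-1}(0)\neq\emptyset$. For $\varepsilon'\ge 0$ let $$B^{[\varepsilon']}(x)=\{v\in X:\ \langle v-v',x-x'\rangle\ge-\varepsilon'\ \text{ whenever } v'\in B(x')\}.$$ Let $x_0\in X$, $\sigma\in[0,1)$ and $\mu,\rho,\varepsilon>0$. The static $\mu$-regularized HPE method with input $(x_0,\sigma,\mu,\rho,\varepsilon)$ performs, for $k=1,2,\dots$, the following iteration. It chooses $\lambda_k>0$ and finds $(y_k,b_k,\varepsilon_k)\in X\times X\times[0,\infty)$ such that $$b_k\in B^{[\varepsilon_k]}(y_k),\qquad \|\lambda_k[b_k+\mu(y_k-x_0)]+y_k-x_{k-1}\|^2+2\lambda_k\varepsilon_k\le\sigma^2\|y_k-x_{k-1}\|^2 .$$ If $\|b_k+\mu(y_k-x_0)\|\le\rho$ and $\varepsilon_k\le\varepsilon$, it stops and outputs $(y_k,b_k,\varepsilon_k)$; otherwise it sets $x_k=x_{k-1}-\lambda_k[b_k+\mu(y_k-x_0)]$ and goes on with iteration $k+1$.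 Let $d_0$ be the distance of $x_0$ to $B^{-1}(0)$. The inclusion $0\in B(x)+\mu(x-x_0)$ has a unique solution $x^*_\mu$; let $d_\mu=\|x^*_\mu-x_0\|$ be the distance of $x_0$ to its solution set. Put $\log^+t=\max\{\log t,0\}$ for $t>0$ and $\log^+0=0$. **Proposition.** Assume that $\lambda_k\ge\underline\lambda>0$ for every iteration $k\ge1$ that is performed. Then, however the $\lambda_k$ and the triples $(y_k,b_k,\varepsilon_k)$ are chosen, the method terminates in at most $$\left(\frac1{2\underline\lambda\mu}+\frac1{1-\sigma^2}\right)\left[2+\max\left\{\log^+\left(\frac{1+\sigma}{1-\sigma}\cdot\frac{d_\mu^2}{\underline\lambda^2\rho^2}\right),\ \log^+\left(\frac{\sigma^2d_\mu^2}{2(1-\sigma^2)\underline\lambda\varepsilon}\right)\right\}\right]$$ iterations, with an output $(y_k,b_k,\varepsilon_k)$ that satisfies $\|b_k+\mu(y_k-x_0)\|\le\rho$, $\varepsilon_k\le\varepsilon$, $$\|y_k-x_0\|\le\left(1+\frac1{\sqrt{1-\sigma^2}}\right)d_\mu\le\left(1+\frac1{\sqrt{1-\sigma^2}}\right)d_0,$$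 $$\|b_k\|\le\rho+\mu\left(1+\frac1{\sqrt{1-\sigma^2}}\right)d_\mu\le\rho+\mu\left(1+\frac1{\sqrt{1-\sigma^2}}\right)d_0 .$$ -/

import Mathlib

namespace RegHPE

variable {X : Type*} [NormedAddCommGroup X] [InnerProductSpace ℝ X]

/-- The graph of the point-to-set operator `B : X ⇉ X`. -/
def graph (B : X → Set X) : Set (X × X) := {p | p.2 ∈ B p.1}

/-- Monotonicity of a point-to-set operator. -/
def IsMonotone (B : X → Set X) : Prop :=
  ∀ p ∈ graph B, ∀ q ∈ graph B, 0 ≤ inner ℝ (p.2 - q.2) (p.1 - q.1)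

/-- Maximal monotonicity: `B` is monotone and no monotone operator has a strictly larger graph. -/
def IsMaximalMonotone (B : X → Set X) : Prop :=
  IsMonotone B ∧ ∀ C : X → Set X, IsMonotone C → graph B ⊆ graph C → B = C

/-- The `ε`-enlargement `B^[ε]` of `B`. -/
def enlargement (B : X → Set X) (ε : ℝ) (x : X) : Set X :=
  {v | ∀ p ∈ graph B, -ε ≤ inner ℝ (v - p.2) (x - p.1)}

/-- The solution set `B⁻¹(0)` of the inclusion `0 ∈ B x`. -/
def zeros (B : X → Set X) : Set X := {x | (0 : X) ∈ B x}

/-- The regularized operator `x ↦ B x + μ (x - x₀)`. -/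
def regularized (B : X → Set X) (μ : ℝ) (x₀ : X) (x : X) : Set X :=
  {v | ∃ b ∈ B x, v = b + μ • (x - x₀)}

/-- `d₀`: the distance of `x₀` to the solution set of `0 ∈ B x`. -/
noncomputable def d0 (B : X → Set X) (x₀ : X) : ℝ :=
  Metric.infDist x₀ (zeros B)

/-- `d_μ`: the distance of `x₀` to the solution set of `0 ∈ B x + μ (x - x₀)`. -/
noncomputable def dmu (B : X → Set X) (μ : ℝ) (x₀ : X) : ℝ :=
  Metric.infDist x₀ (zeros (regularized B μ x₀))

/-- The data `x_k` (`k ≥ 0`) and `λ_k, y_k, b_k, ε_k` (`k ≥ 1`) produced by the method. The values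
at index `0` of all sequences but `x`, and the values after the method has stopped,
are irrelevant. -/
structure Iterates (X : Type*) where
  x : ℕ → X
  lam : ℕ → ℝ
  y : ℕ → X
  b : ℕ → X
  eps : ℕ → ℝ

/-- The residual `v_k = b_k + μ (y_k - x₀)`. -/
def Iterates.residual (s : Iterates X) (x₀ : X) (μ : ℝ) (k : ℕ) : X :=
  s.b k + μ • (s.y k - x₀)

/-- The stopping criterion at iteration `k`. -/
def Iterates.Stops (s : Iterates X) (x₀ : X) (μ ρ ε : ℝ) (k : ℕ) : Prop :=
  ‖s.residual x₀ μ k‖ ≤ ρ ∧ s.eps k ≤ ε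

/-- Iteration `k ≥ 1` is performed: the method has not stopped at an earlier iteration. -/
def Iterates.Performed (s : Iterates X) (x₀ : X) (μ ρ ε : ℝ) (k : ℕ) : Prop :=
  1 ≤ k ∧ ∀ j, 1 ≤ j → j < k → ¬ s.Stops x₀ μ ρ ε j

/-- `s` is a complete execution of the static `μ`-regularized HPE method with input
`(x₀, σ, μ, ρ, ε)`: every iteration `k + 1` that is performed computes `λ, y, b, ε` according to the
relative error criterion, and, if the method does not stop there, makes the extragradient step and
goes on. -/
structure IsExecution (B : X → Set X) (x₀ : X) (σ μ ρ ε : ℝ) (s : Iterates X) : Prop where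
  init : s.x 0 = x₀
  lam_pos : ∀ k, s.Performed x₀ μ ρ ε (k + 1) → 0 < s.lam (k + 1)
  eps_nonneg : ∀ k, s.Performed x₀ μ ρ ε (k + 1) → 0 ≤ s.eps (k + 1)
  mem : ∀ k, s.Performed x₀ μ ρ ε (k + 1) →
    s.b (k + 1) ∈ enlargement B (s.eps (k + 1)) (s.y (k + 1))
  error : ∀ k, s.Performed x₀ μ ρ ε (k + 1) →
    ‖s.lam (k + 1) • s.residual x₀ μ (k + 1) + s.y (k + 1) - s.x k‖ ^ 2
      + 2 * s.lam (k + 1) * s.eps (k + 1) ≤ σ ^ 2 * ‖s.y (k + 1) - s.x k‖ ^ 2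
  update : ∀ k, s.Performed x₀ μ ρ ε (k + 1) → ¬ s.Stops x₀ μ ρ ε (k + 1) →
    s.x (k + 1) = s.x k - s.lam (k + 1) • s.residual x₀ μ (k + 1)

end RegHPE

/-! Let x* solve the regularized inclusion. Testing an enlargement against x* gains `μ‖y - x*‖²`, so
each step lowers `‖x - x*‖²` by at least `2λμ‖y - x*‖² + (1 - σ²)‖y - x‖²` (`hpe_descent`). Since x
- x* is the difference of these two vectors, weighted Cauchy–Schwarz turns the loss into a
contraction by `1 - 1/K`, where `K` is the prefactor of the bound (`hpe_contraction`). Squared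
residual and error are bounded by multiples of `‖x - x*‖²`, so `K log⁺` steps suffice.

Existence of x* is Minty's theorem: the conditions defining it are closed, one of them is compact,
and finitely many are compatible by a minimization argument (`exists_defect_nonpos_of_finset`). -/

namespace RegHPE

/-! ### Existence, uniqueness and size of the regularized solution -/

section Minty

variable {X : Type*} [NormedAddCommGroup X] [InnerProductSpace ℝ X]

/-- The strongly convex function of `x` whose nonpositivity says that `(x, -μ (x - x₀))` is
monotonically related to `p`. -/
def defect (μ : ℝ) (x₀ : X) (p : X × X) (x : X) : ℝ :=
  inner ℝ (p.2 + μ • (x - x₀)) (x - p.1)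

lemma continuous_defect (μ : ℝ) (x₀ : X) (p : X × X) : Continuous (defect μ x₀ p) := by
  unfold defect
  fun_prop

/-- The defect is quadratic in `x` with leading part `μ‖x‖²`, so the gap below the chord is exactly
`μτ(1 - τ)‖y - x‖²`. -/
lemma defect_segment_le {μ : ℝ} (hμ : 0 ≤ μ) (x₀ : X) (p : X × X) (x y : X) {τ : ℝ}
    (h0 : 0 ≤ τ) (h1 : τ ≤ 1) :
    defect μ x₀ p (x + τ • (y - x)) ≤
      defect μ x₀ p x + τ * (defect μ x₀ p y - defect μ x₀ p x) := by
  have key : defect μ x₀ p x + τ * (defect μ x₀ p y - defect μ x₀ p x)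
      - defect μ x₀ p (x + τ • (y - x)) = μ * (τ * (1 - τ)) * inner ℝ (y - x) (y - x) := by
    unfold defect
    simp only [inner_add_left, inner_add_right, inner_sub_left, inner_sub_right,
      real_inner_smul_left, real_inner_smul_right]
    rw [real_inner_comm x y]
    ring
  have : 0 ≤ μ * (τ * (1 - τ)) * inner ℝ (y - x) (y - x) :=
    mul_nonneg (mul_nonneg hμ (mul_nonneg h0 (by linarith))) real_inner_self_nonneg
  linarith

/-- Weighted defects sum to a nonpositive number at the barycentre of the first components. -/
lemma sum_mul_defect_barycenter_nonpos (μ : ℝ) (x₀ : X) (F : Finset (X × X))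
    (hF : ∀ p ∈ F, ∀ q ∈ F, 0 ≤ (inner ℝ (p.2 - q.2) (p.1 - q.1) : ℝ))
    (t : X × X → ℝ) (ht : ∀ p ∈ F, 0 ≤ t p) (hsum : ∑ p ∈ F, t p = 1) :
    ∑ p ∈ F, t p * defect μ x₀ p (∑ q ∈ F, t q • q.1) ≤ 0 := by
  set c := ∑ q ∈ F, t q • q.1 with hc
  have hdef : ∀ p, t p * defect μ x₀ p c =
      t p * inner ℝ p.2 (c - p.1) + inner ℝ (μ • (c - x₀)) (t p • (c - p.1)) := by
    intro p
    unfold defect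
    rw [inner_add_left, real_inner_smul_right]
    ring
  have hzero : ∑ p ∈ F, t p • (c - p.1) = 0 := by
    simp only [smul_sub, Finset.sum_sub_distrib, ← Finset.sum_smul, hsum, one_smul, ← hc, sub_self]
  have hfst : ∀ p : X × X, c - p.1 = ∑ q ∈ F, t q • (q.1 - p.1) := by
    intro p
    simp only [smul_sub, Finset.sum_sub_distrib, ← Finset.sum_smul, hsum, one_smul, ← hc]
  have h1 : ∑ p ∈ F, t p * defect μ x₀ p c =
      ∑ p ∈ F, ∑ q ∈ F, t p * t q * inner ℝ p.2 (q.1 - p.1) := by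
    simp only [hdef, Finset.sum_add_distrib, ← inner_sum, hzero, inner_zero_right, add_zero]
    refine Finset.sum_congr rfl fun p _ => ?_
    rw [hfst p, inner_sum, Finset.mul_sum]
    refine Finset.sum_congr rfl fun q _ => ?_
    rw [real_inner_smul_right]
    ring
  -- Exchanging `p` and `q` and adding the two forms leaves only monotonicity products.
  have h2 : ∑ p ∈ F, t p * defect μ x₀ p c =
      ∑ p ∈ F, ∑ q ∈ F, t p * t q * inner ℝ q.2 (p.1 - q.1) := by
    rw [h1, Finset.sum_comm]
    refine Finset.sum_congr rfl fun p _ => Finset.sum_congr rfl fun q _ => ?_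
    ring
  have h3 : ∑ p ∈ F, t p * defect μ x₀ p c + ∑ p ∈ F, t p * defect μ x₀ p c ≤ 0 := by
    nth_rewrite 1 [h1]
    rw [h2, ← Finset.sum_add_distrib]
    refine Finset.sum_nonpos fun p hp => ?_
    rw [← Finset.sum_add_distrib]
    refine Finset.sum_nonpos fun q hq => ?_
    have h := mul_nonneg (mul_nonneg (ht p hp) (ht q hq)) (hF p hp q hq)
    have e : t p * t q * inner ℝ p.2 (q.1 - p.1) + t p * t q * inner ℝ q.2 (p.1 - q.1) =
        -(t p * t q * inner ℝ (p.2 - q.2) (p.1 - q.1)) := by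
      simp only [inner_sub_left, inner_sub_right]
      ring
    linarith
  linarith

lemma nonneg_of_forall_small_quadratic {a b : ℝ}
    (h : ∀ τ : ℝ, 0 < τ → τ ≤ 1 → 0 ≤ 2 * τ * a + τ ^ 2 * b) : 0 ≤ a := by
  by_contra! ha
  have hb : 0 < |b| + 1 := by positivity
  set τ := min 1 (-a / (|b| + 1)) with hτ
  have h0 : 0 < τ := lt_min one_pos (div_pos (by linarith) hb)
  have h1 := h τ h0 (min_le_left _ _)
  have h2 : τ * (|b| + 1) ≤ -a := (le_div_iff₀ hb).1 (min_le_right _ _)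
  have h3 : τ * b ≤ τ * |b| := mul_le_mul_of_nonneg_left (le_abs_self b) h0.le
  have h4 : τ * (2 * a + τ * b) < 0 := mul_neg_of_pos_of_neg h0 (by linarith)
  linarith [show 2 * τ * a + τ ^ 2 * b = τ * (2 * a + τ * b) by ring]

lemma sq_max_add_le (a d : ℝ) : max (a + d) 0 ^ 2 ≤ (max a 0 + d) ^ 2 := by
  rcases le_total (a + d) 0 with h | h
  · rw [max_eq_right h]
    simpa using sq_nonneg (max a 0 + d)
  · rw [max_eq_left h]
    have := le_max_left a 0
    gcongr

/-- First-order optimality without derivatives: `sq_max_add_le` bounds each squared positive part by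
a quadratic in `τ` whose linear coefficient must then be nonnegative. -/
lemma sum_mul_sub_nonneg_of_forall_le {ι : Type*} (F : Finset ι) (f g : ι → ℝ)
    (h : ∀ τ : ℝ, 0 < τ → τ ≤ 1 →
      ∑ i ∈ F, max (f i) 0 ^ 2 ≤ ∑ i ∈ F, max (f i + τ * (g i - f i)) 0 ^ 2) :
    0 ≤ ∑ i ∈ F, max (f i) 0 * (g i - f i) := by
  refine nonneg_of_forall_small_quadratic (b := ∑ i ∈ F, (g i - f i) ^ 2) fun τ h0 h1 => ?_
  have hle : ∑ i ∈ F, max (f i + τ * (g i - f i)) 0 ^ 2 ≤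
      ∑ i ∈ F, (max (f i) 0 + τ * (g i - f i)) ^ 2 :=
    Finset.sum_le_sum fun i _ => sq_max_add_le _ _
  have e : ∑ i ∈ F, (max (f i) 0 + τ * (g i - f i)) ^ 2 =
      ∑ i ∈ F, max (f i) 0 ^ 2 + (2 * τ * ∑ i ∈ F, max (f i) 0 * (g i - f i)
        + τ ^ 2 * ∑ i ∈ F, (g i - f i) ^ 2) := by
    rw [Finset.mul_sum, Finset.mul_sum, ← Finset.sum_add_distrib, ← Finset.sum_add_distrib]
    exact Finset.sum_congr rfl fun i _ => by ring
  have := h τ h0 h1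
  linarith

/-- The variational inequality at a minimizer of the sum of the squared positive parts. -/
lemma exists_variational_inequality {μ : ℝ} (hμ : 0 ≤ μ) (x₀ : X) (F : Finset (X × X)) {K : Set X}
    (hKc : IsCompact K) (hKconv : Convex ℝ K) (hKn : K.Nonempty) :
    ∃ x, ∀ c ∈ K, 0 ≤ ∑ p ∈ F,
      max (defect μ x₀ p x) 0 * (defect μ x₀ p c - defect μ x₀ p x) := by
  have hcont : Continuous fun x => ∑ p ∈ F, max (defect μ x₀ p x) 0 ^ 2 :=
    continuous_finsetSum _ fun p _ => ((continuous_defect μ x₀ p).max continuous_const).pow 2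
  obtain ⟨x, hxK, hx⟩ := hKc.exists_isMinOn hKn hcont.continuousOn
  refine ⟨x, fun c hcK => sum_mul_sub_nonneg_of_forall_le F _ _ fun τ h0 h1 => ?_⟩
  refine le_trans (isMinOn_iff.1 hx _ (hKconv.add_smul_sub_mem hxK hcK ⟨h0.le, h1⟩)) ?_
  refine Finset.sum_le_sum fun p _ => ?_
  exact pow_le_pow_left₀ (le_max_right _ _)
    (max_le_max_right _ (defect_segment_le hμ x₀ p x c h0.le h1)) 2

/-- The finite Debrunner–Flor theorem for the map `x ↦ μ (x - x₀)`. -/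
lemma exists_defect_nonpos_of_finset {μ : ℝ} (hμ : 0 ≤ μ) (x₀ : X) (F : Finset (X × X))
    (hF : ∀ p ∈ F, ∀ q ∈ F, 0 ≤ (inner ℝ (p.2 - q.2) (p.1 - q.1) : ℝ)) (hne : F.Nonempty) :
    ∃ x, ∀ p ∈ F, defect μ x₀ p x ≤ 0 := by
  obtain ⟨K, hKc, hKconv, hmemK⟩ : ∃ K : Set X, IsCompact K ∧ Convex ℝ K ∧ ∀ p ∈ F, p.1 ∈ K :=
    ⟨convexHull ℝ (Prod.fst '' (F : Set (X × X))),
      (F.finite_toSet.image _).isCompact_convexHull ℝ, convex_convexHull ℝ _,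
      fun p hp => subset_convexHull ℝ _ ⟨p, hp, rfl⟩⟩
  have hKn : K.Nonempty := let ⟨p, hp⟩ := hne; ⟨p.1, hmemK p hp⟩
  obtain ⟨x, hx⟩ := exists_variational_inequality hμ x₀ F hKc hKconv hKn
  refine ⟨x, ?_⟩
  by_contra! hcon
  obtain ⟨p₀, hp₀, hpos⟩ := hcon
  -- The positive parts at the minimizer serve as barycentric weights, and their barycentre `c` as
  -- the test point.
  set w : X × X → ℝ := fun p => max (defect μ x₀ p x) 0 with hw
  have hw0 : ∀ p, 0 ≤ w p := fun p => le_max_right _ _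
  set S := ∑ p ∈ F, w p with hS
  have hSpos : 0 < S :=
    Finset.sum_pos' (fun p _ => hw0 p) ⟨p₀, hp₀, lt_of_lt_of_le hpos (le_max_left _ _)⟩
  set c := ∑ p ∈ F, (w p / S) • p.1 with hc
  have hsum : ∑ p ∈ F, w p / S = 1 := by rw [← Finset.sum_div, div_self hSpos.ne']
  have hcK : c ∈ K := hKconv.sum_mem
    (fun p _ => div_nonneg (hw0 p) hSpos.le) hsum hmemK
  have hbar : ∑ p ∈ F, w p * defect μ x₀ p c ≤ 0 := by
    have h := sum_mul_defect_barycenter_nonpos μ x₀ F hF (fun p => w p / S)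
      (fun p _ => div_nonneg (hw0 p) hSpos.le) hsum
    rw [← hc] at h
    have e : ∑ p ∈ F, w p / S * defect μ x₀ p c = (∑ p ∈ F, w p * defect μ x₀ p c) / S := by
      rw [Finset.sum_div]
      exact Finset.sum_congr rfl fun p _ => by ring
    rw [e] at h
    simpa using (div_le_iff₀ hSpos).1 h
  have hself : ∑ p ∈ F, w p * defect μ x₀ p x = ∑ p ∈ F, w p ^ 2 := by
    refine Finset.sum_congr rfl fun p _ => ?_
    rcases le_total (defect μ x₀ p x) 0 with h | h
    · simp [hw, max_eq_right h]
    · simp [hw, max_eq_left h, sq]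
  have hsq : 0 < ∑ p ∈ F, w p ^ 2 :=
    Finset.sum_pos' (fun p _ => sq_nonneg _)
      ⟨p₀, hp₀, pow_pos (lt_of_lt_of_le hpos (le_max_left _ _)) 2⟩
  -- The weighted defects total at most 0 at `c` but `∑ w² > 0` at `x`, contradicting this
  -- inequality.
  have hvar : 0 ≤ ∑ p ∈ F, w p * (defect μ x₀ p c - defect μ x₀ p x) := hx c hcK
  simp only [mul_sub, Finset.sum_sub_distrib] at hvar
  linarith

/-- The term `μ‖x - p.1‖²` dominates the linear one; this bound supplies the compactness in Minty's
theorem. -/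
lemma norm_le_of_defect_nonpos {μ : ℝ} (hμ : 0 < μ) (x₀ : X) (p : X × X) (x : X)
    (h : defect μ x₀ p x ≤ 0) : ‖x - p.1‖ ≤ ‖p.2 + μ • (p.1 - x₀)‖ / μ := by
  have e : defect μ x₀ p x = inner ℝ (p.2 + μ • (p.1 - x₀)) (x - p.1) + μ * ‖x - p.1‖ ^ 2 := by
    have : p.2 + μ • (x - x₀) = p.2 + μ • (p.1 - x₀) + μ • (x - p.1) := by module
    rw [defect, this, inner_add_left (_ + _), real_inner_smul_left, real_inner_self_eq_norm_sq]
  have h1 := abs_le.1 (abs_real_inner_le_norm (p.2 + μ • (p.1 - x₀)) (x - p.1))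
  rw [le_div_iff₀ hμ]
  by_contra! hcon
  have hpos : 0 < ‖x - p.1‖ := by
    by_contra! h0
    have : ‖x - p.1‖ = 0 := le_antisymm h0 (norm_nonneg _)
    rw [this, zero_mul] at hcon
    linarith [norm_nonneg (p.2 + μ • (p.1 - x₀))]
  have := mul_lt_mul_of_pos_right hcon hpos
  nlinarith

/-- A maximal monotone operator contains every pair that is monotonically related to its graph. -/
lemma IsMaximalMonotone.mem_of_related {B : X → Set X} (hB : IsMaximalMonotone B) {x v : X}
    (h : ∀ p ∈ graph B, 0 ≤ (inner ℝ (v - p.2) (x - p.1) : ℝ)) : v ∈ B x := by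
  have hrel : ∀ p ∈ graph B, 0 ≤ (inner ℝ (p.2 - v) (p.1 - x) : ℝ) := fun p hp => by
    rw [← neg_sub v, ← neg_sub x, inner_neg_neg]
    exact h p hp
  -- Adjoining `(x, v)` to the graph keeps it monotone.
  have hC := hB.2 (fun z => {u | u ∈ B z ∨ (z = x ∧ u = v)}) (by
    rintro ⟨p1, p2⟩ (hp | ⟨rfl, rfl⟩) ⟨q1, q2⟩ (hq | ⟨rfl, rfl⟩)
    · exact hB.1 _ hp _ hq
    · exact hrel _ hp
    · exact h _ hq
    · simp) (fun p hp => Or.inl hp)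
  rw [hC]
  exact Or.inr ⟨rfl, rfl⟩

/-- Minty's theorem in finite dimension: the regularized inclusion has a solution. -/
theorem IsMaximalMonotone.exists_regularized_zero [FiniteDimensional ℝ X] {B : X → Set X}
    (hB : IsMaximalMonotone B) (hne : (graph B).Nonempty) {μ : ℝ} (hμ : 0 < μ) (x₀ : X) :
    ∃ x, -(μ • (x - x₀)) ∈ B x := by
  classical
  have : ProperSpace X := FiniteDimensional.proper ℝ X
  obtain ⟨p₀, hp₀⟩ := hne
  have hcl : ∀ p, IsClosed {x | defect μ x₀ p x ≤ 0} := fun p =>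
    isClosed_le (continuous_defect μ x₀ p) continuous_const
  have hcomp : IsCompact {x | defect μ x₀ p₀ x ≤ 0} :=
    (isCompact_closedBall p₀.1 (‖p₀.2 + μ • (p₀.1 - x₀)‖ / μ)).of_isClosed_subset (hcl p₀)
      fun x hx => by
        rw [Metric.mem_closedBall, dist_eq_norm]
        exact norm_le_of_defect_nonpos hμ x₀ p₀ x hx
  obtain ⟨x, -, hx⟩ := hcomp.inter_iInter_nonempty
    (fun p : graph B => {x | defect μ x₀ p x ≤ 0}) (fun p => hcl p) fun u => by
      obtain ⟨x, hx⟩ := exists_defect_nonpos_of_finset hμ.le x₀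
        (insert p₀ (u.image Subtype.val)) (by
          have hsub : ∀ p ∈ insert p₀ (u.image Subtype.val), p ∈ graph B := by
            intro p hp
            rcases Finset.mem_insert.1 hp with rfl | hp
            · exact hp₀
            · obtain ⟨q, -, rfl⟩ := Finset.mem_image.1 hp
              exact q.2
          exact fun p hp q hq => hB.1 p (hsub p hp) q (hsub q hq)) (Finset.insert_nonempty _ _)
      refine ⟨x, hx _ (Finset.mem_insert_self _ _), ?_⟩
      simp only [Set.mem_iInter]
      exact fun p hp => hx _ (Finset.mem_insert_of_mem (Finset.mem_image_of_mem _ hp))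
  refine ⟨x, hB.mem_of_related fun p hp => ?_⟩
  have h : defect μ x₀ p x ≤ 0 := Set.mem_iInter.1 hx ⟨p, hp⟩
  rw [← neg_add', inner_neg_left, add_comm]
  exact neg_nonneg.2 h

lemma mem_zeros_regularized {B : X → Set X} {μ : ℝ} {x₀ x : X} :
    x ∈ zeros (regularized B μ x₀) ↔ -(μ • (x - x₀)) ∈ B x := by
  constructor
  · rintro ⟨b, hb, h⟩
    rwa [← eq_neg_of_add_eq_zero_left h.symm]
  · exact fun h => ⟨_, h, by simp⟩

lemma IsMonotone.eq_of_mem_zeros_regularized {B : X → Set X} (hB : IsMonotone B) {μ : ℝ}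
    (hμ : 0 < μ) {x₀ x y : X} (hx : -(μ • (x - x₀)) ∈ B x) (hy : -(μ • (y - x₀)) ∈ B y) :
    x = y := by
  have h := hB (x, _) hx (y, _) hy
  have e : -(μ • (x - x₀)) - -(μ • (y - x₀)) = -(μ • (x - y)) := by module
  simp only [e, inner_neg_left, real_inner_smul_left, real_inner_self_eq_norm_sq] at h
  have h1 : ‖x - y‖ ^ 2 ≤ 0 := by
    by_contra! hc
    nlinarith [mul_pos hμ hc]
  have h2 : ‖x - y‖ = 0 := by nlinarith [norm_nonneg (x - y)]
  exact sub_eq_zero.1 (norm_eq_zero.1 h2)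

/-- Monotonicity gives `⟨x - x₀, z - x⟩ ≥ 0`; expanding `‖z - x₀‖²` yields the bound behind `d_μ ≤
d₀`. -/
lemma IsMonotone.norm_regularized_zero_sub_le {B : X → Set X} (hB : IsMonotone B) {μ : ℝ}
    (hμ : 0 < μ) {x₀ x z : X} (hx : -(μ • (x - x₀)) ∈ B x) (hz : z ∈ zeros B) :
    ‖x - x₀‖ ≤ ‖z - x₀‖ := by
  have h := hB (z, 0) hz (x, _) hx
  simp only [zero_sub, neg_neg, real_inner_smul_left] at h
  have h1 : 0 ≤ (inner ℝ (x - x₀) (z - x) : ℝ) := nonneg_of_mul_nonneg_right h hμ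
  have e : z - x₀ = (x - x₀) + (z - x) := by abel
  have h2 := norm_add_sq_real (x - x₀) (z - x)
  rw [← e] at h2
  exact le_of_sq_le_sq (by nlinarith [sq_nonneg ‖z - x‖]) (norm_nonneg _)

end Minty

/-! ### Estimates for a single step -/

section Step

variable {X : Type*} [NormedAddCommGroup X] [InnerProductSpace ℝ X]

lemma inner_residual_ge {B : X → Set X} {μ e : ℝ} {x₀ xs y b : X}
    (hxs : -(μ • (xs - x₀)) ∈ B xs) (hb : b ∈ enlargement B e y) :
    -e + μ * ‖y - xs‖ ^ 2 ≤ inner ℝ (b + μ • (y - x₀)) (y - xs) := by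
  have h := hb (xs, _) hxs
  have e1 : b + μ • (y - x₀) = (b - -(μ • (xs - x₀))) + μ • (y - xs) := by module
  rw [e1, inner_add_left, real_inner_smul_left, real_inner_self_eq_norm_sq]
  linarith

/-- The Fejér-type descent inequality of one hybrid proximal extragradient step. -/
lemma hpe_descent {σ μ lam e : ℝ} {x y v xs : X} (hlam : 0 ≤ lam)
    (hv : -e + μ * ‖y - xs‖ ^ 2 ≤ inner ℝ v (y - xs))
    (herr : ‖lam • v + y - x‖ ^ 2 + 2 * lam * e ≤ σ ^ 2 * ‖y - x‖ ^ 2) :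
    ‖x - lam • v - xs‖ ^ 2 + 2 * lam * μ * ‖y - xs‖ ^ 2 + (1 - σ ^ 2) * ‖y - x‖ ^ 2
      ≤ ‖x - xs‖ ^ 2 := by
  have e1 : x - lam • v - xs = (x - xs) - lam • v := by abel
  have e2 : lam • v + y - x = lam • v + (y - x) := by abel
  have e3 : y - xs = (y - x) + (x - xs) := by abel
  have h := mul_le_mul_of_nonneg_left hv hlam
  have h1 : (inner ℝ v (y - xs) : ℝ) = inner ℝ v (y - x) + inner ℝ v (x - xs) := by
    rw [e3, inner_add_right]
  rw [e2, norm_add_sq_real, real_inner_smul_left] at herr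
  rw [e1, norm_sub_sq_real, real_inner_smul_right, real_inner_comm]
  rw [h1] at h
  linarith

/-- Weighted Cauchy–Schwarz; with weights `2 * lamLow * μ` and `1 - σ ^ 2` its constant is the
prefactor of the iteration bound. -/
lemma sq_le_mul_of_le_add {a c p q D : ℝ} (ha : 0 < a) (hc : 0 < c) (hD : 0 ≤ D)
    (h : D ≤ p + q) : D ^ 2 ≤ (1 / a + 1 / c) * (a * p ^ 2 + c * q ^ 2) := by
  have h1 : D ^ 2 ≤ (p + q) ^ 2 := by gcongr
  have h2 : (1 / a + 1 / c) * (a * p ^ 2 + c * q ^ 2) - (p + q) ^ 2 =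
      (a * p - c * q) ^ 2 / (a * c) := by
    field_simp
    ring
  have h3 : 0 ≤ (a * p - c * q) ^ 2 / (a * c) := by positivity
  linarith

/-- One step contracts the squared distance to the regularized solution. -/
lemma hpe_contraction {σ μ lam lamLow e : ℝ} {x y v xs : X} (hσ : 0 < 1 - σ ^ 2) (hμ : 0 < μ)
    (hlow : 0 < lamLow) (hlam : lamLow ≤ lam)
    (hv : -e + μ * ‖y - xs‖ ^ 2 ≤ inner ℝ v (y - xs))
    (herr : ‖lam • v + y - x‖ ^ 2 + 2 * lam * e ≤ σ ^ 2 * ‖y - x‖ ^ 2) :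
    ‖x - lam • v - xs‖ ^ 2 ≤
      (1 - 1 / (1 / (2 * lamLow * μ) + 1 / (1 - σ ^ 2))) * ‖x - xs‖ ^ 2 := by
  have h := hpe_descent (hlow.le.trans hlam) hv herr
  have htri : ‖x - xs‖ ≤ ‖y - xs‖ + ‖y - x‖ := by
    rw [norm_sub_rev y x, add_comm]
    exact norm_sub_le_norm_sub_add_norm_sub x y xs
  have ha : 0 < 2 * lamLow * μ := by positivity
  have h1 := sq_le_mul_of_le_add ha hσ (norm_nonneg _) htri
  have hK : 0 < 1 / (2 * lamLow * μ) + 1 / (1 - σ ^ 2) := by positivity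
  have h2 : 1 / (1 / (2 * lamLow * μ) + 1 / (1 - σ ^ 2)) * ‖x - xs‖ ^ 2 ≤
      2 * lamLow * μ * ‖y - xs‖ ^ 2 + (1 - σ ^ 2) * ‖y - x‖ ^ 2 := by
    rw [one_div_mul_eq_div, div_le_iff₀ hK, mul_comm]
    exact h1
  have h3 : 2 * lamLow * μ * ‖y - xs‖ ^ 2 ≤ 2 * lam * μ * ‖y - xs‖ ^ 2 := by gcongr
  linarith

lemma hpe_norm_sub_sq_le {σ μ lam e : ℝ} {x y v xs : X} (hμ : 0 ≤ μ) (hlam : 0 ≤ lam)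
    (hv : -e + μ * ‖y - xs‖ ^ 2 ≤ inner ℝ v (y - xs))
    (herr : ‖lam • v + y - x‖ ^ 2 + 2 * lam * e ≤ σ ^ 2 * ‖y - x‖ ^ 2) :
    (1 - σ ^ 2) * ‖y - x‖ ^ 2 ≤ ‖x - xs‖ ^ 2 := by
  have h := hpe_descent hlam hv herr
  have : 0 ≤ 2 * lam * μ * ‖y - xs‖ ^ 2 := by positivity
  linarith [sq_nonneg ‖x - lam • v - xs‖]

/-- The triangle inequality gives `λ‖v‖ ≤ (1 + σ)‖y - x‖`, and `(1 + σ)²/(1 - σ²) = (1 + σ)/(1 -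
σ)`. -/
lemma hpe_residual_sq_le {σ μ lam lamLow e : ℝ} {x y v xs : X} (hσ0 : 0 ≤ σ) (hσ1 : σ < 1)
    (hμ : 0 ≤ μ) (hlow : 0 < lamLow) (hlam : lamLow ≤ lam) (he : 0 ≤ e)
    (hv : -e + μ * ‖y - xs‖ ^ 2 ≤ inner ℝ v (y - xs))
    (herr : ‖lam • v + y - x‖ ^ 2 + 2 * lam * e ≤ σ ^ 2 * ‖y - x‖ ^ 2) :
    lamLow ^ 2 * ‖v‖ ^ 2 ≤ (1 + σ) / (1 - σ) * ‖x - xs‖ ^ 2 := by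
  have hl : 0 ≤ lam := hlow.le.trans hlam
  have h := hpe_norm_sub_sq_le hμ hl hv herr
  have h1 : ‖lam • v + y - x‖ ≤ σ * ‖y - x‖ := by
    refine le_of_sq_le_sq ?_ (by positivity)
    have : 0 ≤ 2 * lam * e := by positivity
    rw [mul_pow]
    linarith
  have h2 : lam * ‖v‖ ≤ (1 + σ) * ‖y - x‖ := by
    have e1 : lam • v = (lam • v + y - x) - (y - x) := by abel
    have h3 := norm_sub_le (lam • v + y - x) (y - x)
    rw [← e1, norm_smul, Real.norm_of_nonneg hl] at h3
    linarith
  have h3 : lamLow * ‖v‖ ≤ (1 + σ) * ‖y - x‖ :=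
    (mul_le_mul_of_nonneg_right hlam (norm_nonneg _)).trans h2
  have h4 : (lamLow * ‖v‖) ^ 2 ≤ ((1 + σ) * ‖y - x‖) ^ 2 := by gcongr
  have hs : 0 < 1 - σ := by linarith
  rw [div_mul_eq_mul_div, le_div_iff₀ hs]
  have h5 := mul_le_mul_of_nonneg_right h4 hs.le
  have h6 := mul_le_mul_of_nonneg_left h (show 0 ≤ 1 + σ by linarith)
  linarith

lemma hpe_error_le {σ μ lam lamLow e : ℝ} {x y v xs : X} (hσ : 0 < 1 - σ ^ 2)
    (hμ : 0 ≤ μ) (hlow : 0 < lamLow) (hlam : lamLow ≤ lam) (he : 0 ≤ e)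
    (hv : -e + μ * ‖y - xs‖ ^ 2 ≤ inner ℝ v (y - xs))
    (herr : ‖lam • v + y - x‖ ^ 2 + 2 * lam * e ≤ σ ^ 2 * ‖y - x‖ ^ 2) :
    2 * (1 - σ ^ 2) * lamLow * e ≤ σ ^ 2 * ‖x - xs‖ ^ 2 := by
  have h := hpe_norm_sub_sq_le hμ (hlow.le.trans hlam) hv herr
  have h1 : 2 * lamLow * e ≤ σ ^ 2 * ‖y - x‖ ^ 2 := by
    have : 2 * lamLow * e ≤ 2 * lam * e := by gcongr
    linarith [sq_nonneg ‖lam • v + y - x‖]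
  have h2 := mul_le_mul_of_nonneg_left h1 hσ.le
  have h3 := mul_le_mul_of_nonneg_left h (sq_nonneg σ)
  linarith

lemma hpe_norm_sub_solution_le {σ μ lam e : ℝ} {x y v xs : X} (hσ0 : 0 ≤ σ) (hσ : 0 < 1 - σ ^ 2)
    (hμ : 0 ≤ μ) (hlam : 0 ≤ lam) (he : 0 ≤ e)
    (hv : -e + μ * ‖y - xs‖ ^ 2 ≤ inner ℝ v (y - xs))
    (herr : ‖lam • v + y - x‖ ^ 2 + 2 * lam * e ≤ σ ^ 2 * ‖y - x‖ ^ 2) :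
    ‖y - xs‖ ≤ 1 / √(1 - σ ^ 2) * ‖x - xs‖ := by
  have h := hpe_descent hlam hv herr
  have h0 : 0 ≤ 2 * lam * μ * ‖y - xs‖ ^ 2 := by positivity
  have h1 : ‖lam • v + y - x‖ ≤ σ * ‖y - x‖ := by
    refine le_of_sq_le_sq ?_ (by positivity)
    have : 0 ≤ 2 * lam * e := by positivity
    rw [mul_pow]
    linarith
  have h2 : ‖y - xs‖ ≤ σ * ‖y - x‖ + ‖x - lam • v - xs‖ := by
    have e1 : y - xs = (lam • v + y - x) + (x - lam • v - xs) := by abel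
    have h3 := norm_add_le (lam • v + y - x) (x - lam • v - xs)
    rw [← e1] at h3
    linarith
  rw [one_div_mul_eq_div, le_div_iff₀ (Real.sqrt_pos.2 hσ)]
  refine le_of_sq_le_sq ?_ (norm_nonneg _)
  rw [mul_pow, Real.sq_sqrt hσ.le]
  have h3 : ‖y - xs‖ ^ 2 ≤ (σ * ‖y - x‖ + ‖x - lam • v - xs‖) ^ 2 := by gcongr
  have h4 := mul_le_mul_of_nonneg_right h3 hσ.le
  -- With `p = ‖y - x‖` and `q` the new distance, this square is `(1 - σ²)p² + q² - (1 - σ²)(σp +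
  -- q)²`.
  have h5 := sq_nonneg (σ * ‖x - lam • v - xs‖ - (1 - σ ^ 2) * ‖y - x‖)
  linarith

end Step

/-! ### Geometric decay and the iteration count -/

section Complexity

variable {X : Type*} [NormedAddCommGroup X] [InnerProductSpace ℝ X]

lemma Iterates.Performed.pred {s : Iterates X} {x₀ : X} {μ ρ ε : ℝ} {n : ℕ}
    (h : s.Performed x₀ μ ρ ε (n + 2)) : s.Performed x₀ μ ρ ε (n + 1) :=
  ⟨by omega, fun j h1 h2 => h.2 j h1 (by omega)⟩

lemma IsExecution.norm_sub_sq_le {B : X → Set X} {x₀ xs : X} {σ μ ρ ε lamLow : ℝ}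
    {s : Iterates X} (hs : IsExecution B x₀ σ μ ρ ε s) (hσ : 0 < 1 - σ ^ 2) (hμ : 0 < μ)
    (hlow : 0 < lamLow) (hlam : ∀ k, s.Performed x₀ μ ρ ε k → lamLow ≤ s.lam k)
    (hxs : -(μ • (xs - x₀)) ∈ B xs)
    (hK : 0 ≤ 1 - 1 / (1 / (2 * lamLow * μ) + 1 / (1 - σ ^ 2))) (n : ℕ)
    (hn : s.Performed x₀ μ ρ ε (n + 1)) :
    ‖s.x n - xs‖ ^ 2 ≤
      (1 - 1 / (1 / (2 * lamLow * μ) + 1 / (1 - σ ^ 2))) ^ n * ‖xs - x₀‖ ^ 2 := by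
  induction n with
  | zero => rw [hs.init, pow_zero, one_mul, norm_sub_rev]
  | succ n ih =>
    have hp := hn.pred
    rw [hs.update n hp (hn.2 (n + 1) (by omega) (by omega)),
      pow_succ' (1 - 1 / (1 / (2 * lamLow * μ) + 1 / (1 - σ ^ 2))) n, mul_assoc (1 - _)]
    exact (hpe_contraction hσ hμ hlow (hlam _ hp) (inner_residual_ge hxs (hs.mem n hp))
      (hs.error n hp)).trans (mul_le_mul_of_nonneg_left (ih hp) hK)

/-- Geometric decay with ratio `1 - 1 / K` brings `A` below `1` after `K log⁺ A` steps. -/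
lemma geometric_mul_le_one {K A : ℝ} (hK : 1 < K) (hA : 0 ≤ A) {n : ℕ}
    (hn : K * Real.posLog A ≤ n) : (1 - 1 / K) ^ n * A ≤ 1 := by
  have hK0 : 0 < K := one_pos.trans hK
  have hr : 0 ≤ 1 - 1 / K := by
    have := (div_le_one hK0).2 hK.le
    linarith
  have h1 : (1 - 1 / K) ^ n ≤ Real.exp (-(n / K)) := by
    have h := Real.add_one_le_exp (-(1 / K))
    calc (1 - 1 / K) ^ n ≤ Real.exp (-(1 / K)) ^ n := pow_le_pow_left₀ hr (by linarith) n
      _ = Real.exp (-(n / K)) := by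
        rw [← Real.exp_nat_mul]
        congr 1
        ring
  have h2 : A ≤ Real.exp (Real.posLog A) := by
    rw [Real.posLog_eq_log_max_one hA, Real.exp_log (by positivity)]
    exact le_max_right _ _
  have h3 : Real.posLog A ≤ n / K := by
    rw [le_div_iff₀ hK0, mul_comm]
    exact hn
  calc (1 - 1 / K) ^ n * A ≤ Real.exp (-(n / K)) * Real.exp (n / K) :=
        mul_le_mul h1 (h2.trans (Real.exp_le_exp.2 h3)) hA (Real.exp_pos _).le
    _ = 1 := by rw [← Real.exp_add, neg_add_cancel, Real.exp_zero]

/-- An iteration that is performed late enough meets the stopping criterion. -/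
lemma IsExecution.stops_of_le {B : X → Set X} {x₀ xs : X} {σ μ ρ ε lamLow : ℝ}
    {s : Iterates X} (hs : IsExecution B x₀ σ μ ρ ε s) (hσ0 : 0 ≤ σ) (hσ1 : σ < 1) (hμ : 0 < μ)
    (hρ : 0 < ρ) (hε : 0 < ε)
    (hlow : 0 < lamLow) (hlam : ∀ k, s.Performed x₀ μ ρ ε k → lamLow ≤ s.lam k)
    (hxs : -(μ • (xs - x₀)) ∈ B xs)
    (hK : 1 < 1 / (2 * lamLow * μ) + 1 / (1 - σ ^ 2)) {n : ℕ}
    (hn : s.Performed x₀ μ ρ ε (n + 1))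
    (hle : (1 / (2 * lamLow * μ) + 1 / (1 - σ ^ 2)) * max
      (Real.posLog ((1 + σ) / (1 - σ) * (‖xs - x₀‖ ^ 2 / (lamLow ^ 2 * ρ ^ 2))))
      (Real.posLog (σ ^ 2 * ‖xs - x₀‖ ^ 2 / (2 * (1 - σ ^ 2) * lamLow * ε))) ≤ n) :
    s.Stops x₀ μ ρ ε (n + 1) := by
  have hσ : 0 < 1 - σ ^ 2 := by nlinarith
  have hσ' : 0 < 1 - σ := by linarith
  have hx := hs.norm_sub_sq_le hσ hμ hlow hlam hxs
    (by have := (div_le_one (one_pos.trans hK)).2 hK.le; linarith) n hn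
  have hv := inner_residual_ge hxs (hs.mem n hn)
  have hr := hpe_residual_sq_le hσ0 hσ1 hμ.le hlow (hlam _ hn) (hs.eps_nonneg n hn) hv
    (hs.error n hn)
  have he := hpe_error_le hσ hμ.le hlow (hlam _ hn) (hs.eps_nonneg n hn) hv (hs.error n hn)
  set K := 1 / (2 * lamLow * μ) + 1 / (1 - σ ^ 2) with hKdef
  have hK0 : 0 ≤ K := by linarith
  have g1 := geometric_mul_le_one hK (by positivity)
    ((mul_le_mul_of_nonneg_left (le_max_left _ _) hK0).trans hle)
  have g2 := geometric_mul_le_one hK (by positivity)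
    ((mul_le_mul_of_nonneg_left (le_max_right _ _) hK0).trans hle)
  constructor
  · refine le_of_sq_le_sq ?_ hρ.le
    have h1 : lamLow ^ 2 * ‖s.residual x₀ μ (n + 1)‖ ^ 2 ≤
        (1 + σ) / (1 - σ) * ((1 - 1 / K) ^ n * ‖xs - x₀‖ ^ 2) :=
      hr.trans (mul_le_mul_of_nonneg_left hx (by positivity))
    have h2 : (1 + σ) / (1 - σ) * ((1 - 1 / K) ^ n * ‖xs - x₀‖ ^ 2) =
        (1 - 1 / K) ^ n * ((1 + σ) / (1 - σ) * (‖xs - x₀‖ ^ 2 / (lamLow ^ 2 * ρ ^ 2))) *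
          (lamLow ^ 2 * ρ ^ 2) := by
      field_simp
    rw [h2] at h1
    have h3 := h1.trans (mul_le_mul_of_nonneg_right g1 (by positivity))
    rw [one_mul] at h3
    exact le_of_mul_le_mul_left h3 (by positivity)
  · have hc : 0 < 2 * (1 - σ ^ 2) * lamLow := by positivity
    have h1 : 2 * (1 - σ ^ 2) * lamLow * s.eps (n + 1) ≤
        σ ^ 2 * ((1 - 1 / K) ^ n * ‖xs - x₀‖ ^ 2) :=
      he.trans (mul_le_mul_of_nonneg_left hx (by positivity))
    have h2 : σ ^ 2 * ((1 - 1 / K) ^ n * ‖xs - x₀‖ ^ 2) =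
        (1 - 1 / K) ^ n * (σ ^ 2 * ‖xs - x₀‖ ^ 2 / (2 * (1 - σ ^ 2) * lamLow * ε)) *
          (2 * (1 - σ ^ 2) * lamLow * ε) := by
      field_simp
    rw [h2] at h1
    have h3 := h1.trans (mul_le_mul_of_nonneg_right g2 (by positivity))
    rw [one_mul] at h3
    exact le_of_mul_le_mul_left h3 hc

end Complexity

end RegHPE

theorem proposition3p2 {X : Type*} [NormedAddCommGroup X] [InnerProductSpace ℝ X]
    [FiniteDimensional ℝ X] (B : X → Set X) (hB : RegHPE.IsMaximalMonotone B)
    (hzero : (RegHPE.zeros B).Nonempty)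
    (x₀ : X) (σ μ ρ ε lamLow : ℝ) (hσ0 : 0 ≤ σ) (hσ1 : σ < 1) (hμ : 0 < μ) (hρ : 0 < ρ)
    (hε : 0 < ε) (hlamLow : 0 < lamLow)
    (s : RegHPE.Iterates X) (hs : RegHPE.IsExecution B x₀ σ μ ρ ε s)
    (hlam : ∀ k, s.Performed x₀ μ ρ ε k → lamLow ≤ s.lam k) :
    -- the regularized inclusion has a unique solution, and `d_μ` is its distance to `x₀`
    (∃ xμ : X, RegHPE.zeros (RegHPE.regularized B μ x₀) = {xμ} ∧
      RegHPE.dmu B μ x₀ = ‖xμ - x₀‖) ∧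
    -- the method stops at some iteration `k` within the bound, with the stated output
    ∃ k : ℕ, s.Performed x₀ μ ρ ε k ∧
      (k : ℝ) ≤ (1 / (2 * lamLow * μ) + 1 / (1 - σ ^ 2)) *
        (2 + max
          (Real.posLog ((1 + σ) / (1 - σ) * (RegHPE.dmu B μ x₀ ^ 2 / (lamLow ^ 2 * ρ ^ 2))))
          (Real.posLog (σ ^ 2 * RegHPE.dmu B μ x₀ ^ 2 / (2 * (1 - σ ^ 2) * lamLow * ε)))) ∧
      ‖s.b k + μ • (s.y k - x₀)‖ ≤ ρ ∧ s.eps k ≤ ε ∧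
      ‖s.y k - x₀‖ ≤ (1 + 1 / √(1 - σ ^ 2)) * RegHPE.dmu B μ x₀ ∧
      (1 + 1 / √(1 - σ ^ 2)) * RegHPE.dmu B μ x₀ ≤ (1 + 1 / √(1 - σ ^ 2)) * RegHPE.d0 B x₀ ∧
      ‖s.b k‖ ≤ ρ + μ * (1 + 1 / √(1 - σ ^ 2)) * RegHPE.dmu B μ x₀ ∧
      ρ + μ * (1 + 1 / √(1 - σ ^ 2)) * RegHPE.dmu B μ x₀ ≤
        ρ + μ * (1 + 1 / √(1 - σ ^ 2)) * RegHPE.d0 B x₀ := by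
  classical
  obtain ⟨z₀, hz₀⟩ := hzero
  obtain ⟨xμ, hxμ⟩ := hB.exists_regularized_zero ⟨(z₀, 0), hz₀⟩ hμ x₀
  have hset : RegHPE.zeros (RegHPE.regularized B μ x₀) = {xμ} := by
    ext x
    rw [RegHPE.mem_zeros_regularized, Set.mem_singleton_iff]
    exact ⟨fun hx => hB.1.eq_of_mem_zeros_regularized hμ hx hxμ, fun h => h ▸ hxμ⟩
  have hd : RegHPE.dmu B μ x₀ = ‖xμ - x₀‖ := by
    rw [RegHPE.dmu, hset, Metric.infDist_singleton, dist_eq_norm, norm_sub_rev]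
  refine ⟨⟨xμ, hset, hd⟩, ?_⟩
  have hd0 : ‖xμ - x₀‖ ≤ RegHPE.d0 B x₀ := by
    refine (Metric.le_infDist ⟨z₀, hz₀⟩).2 fun z hz => ?_
    rw [dist_eq_norm, norm_sub_rev x₀]
    exact hB.1.norm_regularized_zero_sub_le hμ hxμ hz
  rw [hd]
  have hσ : 0 < 1 - σ ^ 2 := by nlinarith
  have hK : 1 < 1 / (2 * lamLow * μ) + 1 / (1 - σ ^ 2) := by
    have h1 : 1 ≤ 1 / (1 - σ ^ 2) := (one_le_div hσ).2 (by linarith [sq_nonneg σ])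
    have h2 : 0 < 1 / (2 * lamLow * μ) := by positivity
    linarith
  set K := 1 / (2 * lamLow * μ) + 1 / (1 - σ ^ 2) with hKdef
  set M := max (Real.posLog ((1 + σ) / (1 - σ) * (‖xμ - x₀‖ ^ 2 / (lamLow ^ 2 * ρ ^ 2))))
    (Real.posLog (σ ^ 2 * ‖xμ - x₀‖ ^ 2 / (2 * (1 - σ ^ 2) * lamLow * ε))) with hM
  have hM0 : 0 ≤ M := Real.posLog_nonneg.trans (le_max_left _ _)
  -- Without an earlier stop, iteration `⌈K * M⌉₊ + 1` is performed and late enough to stop.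
  have hex : ∃ n, n ≤ ⌈K * M⌉₊ ∧ s.Stops x₀ μ ρ ε (n + 1) := by
    by_contra! hcon
    refine hcon _ le_rfl (hs.stops_of_le hσ0 hσ1 hμ hρ hε hlamLow hlam hxμ hK
      ⟨by omega, fun j h1 h2 => ?_⟩ (Nat.le_ceil _))
    obtain ⟨i, rfl⟩ : ∃ i, j = i + 1 := ⟨j - 1, by omega⟩
    exact hcon i (by omega)
  obtain ⟨hn, hfin⟩ := Nat.find_spec hex
  set n := Nat.find hex with hndef
  have hperf : s.Performed x₀ μ ρ ε (n + 1) := by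
    refine ⟨by omega, fun j h1 h2 hj => ?_⟩
    obtain ⟨i, rfl⟩ : ∃ i, j = i + 1 := ⟨j - 1, by omega⟩
    exact Nat.find_min hex (show i < n by omega) ⟨by omega, hj⟩
  have hθ : 1 / K ≤ 1 := (div_le_one (by linarith)).2 hK.le
  have hθ0 : 0 ≤ 1 / K := by positivity
  have hx : ‖s.x n - xμ‖ ≤ ‖xμ - x₀‖ := by
    refine le_of_sq_le_sq ((hs.norm_sub_sq_le hσ hμ hlamLow hlam hxμ
      (by linarith) n hperf).trans ?_) (norm_nonneg _)
    exact mul_le_of_le_one_left (sq_nonneg _) (pow_le_one₀ (by linarith) (by linarith))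
  have hy : ‖s.y (n + 1) - x₀‖ ≤ (1 + 1 / √(1 - σ ^ 2)) * ‖xμ - x₀‖ := by
    have h1 := RegHPE.hpe_norm_sub_solution_le hσ0 hσ hμ.le (hs.lam_pos n hperf).le
      (hs.eps_nonneg n hperf) (RegHPE.inner_residual_ge hxμ (hs.mem n hperf)) (hs.error n hperf)
    have h2 : 1 / √(1 - σ ^ 2) * ‖s.x n - xμ‖ ≤ 1 / √(1 - σ ^ 2) * ‖xμ - x₀‖ := by gcongr
    have h3 := norm_sub_le_norm_sub_add_norm_sub (s.y (n + 1)) xμ x₀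
    linarith
  refine ⟨n + 1, hperf, ?_, hfin.1, hfin.2, hy, by gcongr, ?_, by gcongr⟩
  -- Rounding up and the index shift cost at most 2, which is below `2 * K` because `K > 1`.
  · have h1 : (n : ℝ) ≤ ⌈K * M⌉₊ := by exact_mod_cast hn
    have h2 := Nat.ceil_lt_add_one (show 0 ≤ K * M by positivity)
    push_cast
    linarith
  · have h1 : s.b (n + 1) = s.residual x₀ μ (n + 1) - μ • (s.y (n + 1) - x₀) := by
      simp [RegHPE.Iterates.residual]
    have h2 := norm_sub_le (s.residual x₀ μ (n + 1)) (μ • (s.y (n + 1) - x₀))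
    rw [← h1, norm_smul, Real.norm_of_nonneg hμ.le] at h2
    have h3 := mul_le_mul_of_nonneg_left hy hμ.le
    linarith [hfin.1]
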